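/- Let $q$ be a prime power, let $t\ge 1$, and let $n_1,\dots,n_t,m_1,\dots,m_t\ge 1$ be integers with $n_i\le m_i$ for all $i$ and $m_1\ge\cdots\ge m_t$. Put $\Pi=\bigoplus_{i=1}^t\mathbb F_q^{n_i\times m_i}$ and let $\mathcal L=\mathcal L_1\times\cdots\times\mathcal L_t$, where $\mathcal L_i$ is the lattice of subspaces of $\mathbb F_q^{n_i}$. For an $\mathbb F_q$-linear subspace (code) $C\le\Pi$ and $U=(U_1,\dots,U_t)\in\mathcal L$ let $$W_U(C)=\big|\{(X_1,\dots,X_t)\in C : \operatorname{colsp}(X_i)=U_i\text{ for all }i\}\big|,$$ where $\operatorname{colsp}$ denotes the column space; the list $(W_U(C))_{U\in\mathcal L}$ is the support distribution of $C$. Let $$C^\perp=\Big\{(Y_1,\dots,Y_t)\in\Pi : \sum_{i=1}^t\operatorname{Tr}(X_iY_i^{\top})=0\text{ for all }(X_1,\dots,X_t)\in C\Big\},$$ let $H_i^\perp$ be the orthogonal of $H_i\le\mathbb F_q^{n_i}$ with respect to the standard inner product, and let $\left[{a\atop b}\right]_q=\prod_{j=0}^{b-1}\frac{q^a-q^j}{q^b-q^j}$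 be the Gaussian binomial coefficient. For $U,H\in\mathcal L$ with $u_i=\dim U_i$ put $$K(U,H)=\sum_{v\in\mathbb Z_{\ge0}^t,\ v_i\le u_i\,\forall i} q^{\sum_{i=1}^t m_iv_i}\prod_{i=1}^t(-1)^{u_i-v_i}\,q^{\binom{u_i-v_i}{2}}\left[{\dim(H_i^\perp\cap U_i)\atop v_i}\right]_q .$$ Then for every code $C\le\Pi$ and every $U\in\mathcal L$ $$W_U(C^\perp)=\frac1{|C|}\sum_{H\in\mathcal L}W_H(C)\,K(U,H).$$ In particular, the support distribution of $C^\perp$ is uniquely determined by that of $C$ (two codes in $\Pi$ with the same support distribution have duals with the same support distribution), via an invertible linear transformation: the linear map $T:\mathbb Q^{\mathcal L}\to\mathbb Q^{\mathcal L}$, $(Tw)_U=\sum_{H\in\mathcal L}w_H\,K(U,H)$, is bijective, and $(W_U(C^\perp))_{U\in\mathcal L}=\frac1{|C|}\,T\big((W_H(C))_{H\in\mathcal L}\big)$ for every code $C\le\Pi$. -/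

import Mathlib

namespace SumRank

open scoped Matrix

/-- The ambient space `Π = F^(n₁ × m₁) × ⋯ × F^(n_t × m_t)` of tuples of matrices. -/
abbrev Space (F : Type*) {t : ℕ} (n m : Fin t → ℕ) : Type _ :=
  (i : Fin t) → Matrix (Fin (n i)) (Fin (m i)) F

/-- The product of the lattices of subspaces of `F^(n₁), …, F^(n_t)`
(with the product order, which is the order Mathlib puts on a pi type). -/
abbrev Lattice (F : Type*) [Field F] {t : ℕ} (n : Fin t → ℕ) : Type _ :=
  (i : Fin t) → Submodule F (Fin (n i) → F)

/-- Over a finite field the product lattice is finite. -/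
noncomputable instance instFintypeLattice (F : Type*) [Field F] [Fintype F] {t : ℕ}
    (n : Fin t → ℕ) : Fintype (Lattice F n) :=
  Fintype.ofFinite _

section

variable {F : Type*} [Field F] {t : ℕ} {n m : Fin t → ℕ}

/-- The column space of a matrix. -/
def colsp {a b : ℕ} (M : Matrix (Fin a) (Fin b) F) : Submodule F (Fin a → F) :=
  Submodule.span F (Set.range M.col)

/-- The support of a tuple of matrices: the tuple of the column spaces of its blocks. -/
def support (X : Space F n m) : Lattice F n :=
  fun i => colsp (X i)

/-- The support distribution of a code `C`: the number `W_U(C)` of elements of `C` with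
support `U`. -/
noncomputable def suppDist (C : Submodule F (Space F n m)) (U : Lattice F n) : ℕ :=
  Nat.card {X : Space F n m // X ∈ C ∧ support X = U}

/-- The dual of a code with respect to the sum of the trace products `⟨X, Y⟩ = Tr(X Yᵀ)`
of the blocks. -/
def dual (C : Submodule F (Space F n m)) : Submodule F (Space F n m) where
  carrier := {Y | ∀ X ∈ C, ∑ i, (X i * (Y i)ᵀ).trace = 0}
  zero_mem' := by
    intro X _
    simp
  add_mem' := by
    intro Y Z hY hZ X hX
    have h1 := hY X hX
    have h2 := hZ X hX
    simp [Matrix.mul_add, Finset.sum_add_distrib, h1, h2]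
  smul_mem' := by
    intro c Y hY X hX
    have h1 := hY X hX
    simp [← Finset.mul_sum, h1]

/-- The orthogonal of a subspace with respect to the standard inner product of `F^a`. -/
def orth {a : ℕ} (V : Submodule F (Fin a → F)) : Submodule F (Fin a → F) where
  carrier := {y | ∀ x ∈ V, x ⬝ᵥ y = 0}
  zero_mem' := by
    intro x _
    simp
  add_mem' := by
    intro y z hy hz x hx
    simp [dotProduct_add, hy x hx, hz x hx]
  smul_mem' := by
    intro c y hy x hx
    simp [dotProduct_smul, hy x hx]

/-- The vector of dimensions of an element of the product lattice. -/
noncomputable def dimVec (U : Lattice F n) : Fin t → ℕ :=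
  fun i => Module.finrank F (U i)

end

/-- The Gaussian binomial coefficient
`[a, b]_q = ∏_{j < b} (q^a - q^j) / (q^b - q^j)`, for `q ≥ 2`; it is `0` for `b > a`
(the factor with `j = a` vanishes) and `1` for `b = 0`. -/
def gaussBinom (q a b : ℕ) : ℚ :=
  ∏ j ∈ Finset.range b, ((q : ℚ) ^ a - (q : ℚ) ^ j) / ((q : ℚ) ^ b - (q : ℚ) ^ j)

/-- The coefficient of `W_H(C)` in the formula for `|C| * W_U(C^⊥)`, where `q = |F|`, `u_i = dim U_i`:
the sum over all `v ≤ u` in `ℕ^t` of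
`q^(∑ m_i v_i) * ∏ (-1)^(u_i - v_i) * q^((u_i - v_i) choose 2) * [dim(H_i^⊥ ∩ U_i), v_i]_q`.
The subtractions do not truncate since `v ≤ u`. -/
noncomputable def coeff {F : Type*} [Field F] [Fintype F] {t : ℕ} {n : Fin t → ℕ}
    (m : Fin t → ℕ) (U H : Lattice F n) : ℚ :=
  ∑ v ∈ Finset.Iic (dimVec U),
    (Fintype.card F : ℚ) ^ (∑ i, m i * v i) *
      ∏ i, ((-1 : ℚ) ^ (dimVec U i - v i) *
        (Fintype.card F : ℚ) ^ ((dimVec U i - v i).choose 2) *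
        gaussBinom (Fintype.card F) (Module.finrank F ↥(orth (H i) ⊓ U i)) (v i))

end SumRank

namespace SumRank

open Module
open scoped Matrix

/-! ### Gaussian binomial coefficients -/

section GaussBinom

variable {q : ℕ}

/-! Fix a nontrivial additive character χ of F and sum χ(⟨X, Y⟩) over X ∈ C and all Y with support
U. Summing over X first gives |C| · W_U(C^⊥) by orthogonality (`sum_addChar_linearMap`). Summing
over Y first gives a number that depends only on the support of X, namely the coefficient K
(`sum_support_eq_addChar`). The second sum factors over the blocks. In one block, the sum over colsp
Y ≤ U is q^(b dim U) or 0, according to whether U ≤ (colsp X)^⊥. Möbius inversion in the subspace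
lattice passes to colsp Y = U (`sum_colsp_eq_addChar`). The Möbius function comes from the
q-binomial theorem, and grouping subspaces by dimension produces the Gaussian binomials. For
invertibility, the same character sums show that K² is |Π| times the identity
(`sum_coeff_mul_coeff`). -/

theorem pow_sub_pow_ne_zero (hq : 1 < q) {a j : ℕ} (h : j ≠ a) : (q : ℚ) ^ a - (q : ℚ) ^ j ≠ 0 := by
  intro h0
  apply h
  have h1 : q ^ j = q ^ a := by exact_mod_cast (sub_eq_zero.1 h0).symm
  exact Nat.pow_right_injective hq h1

theorem gaussBinom_zero_right (q a : ℕ) : gaussBinom q a 0 = 1 := by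
  simp [gaussBinom]

theorem gaussBinom_eq_zero_of_lt {a b : ℕ} (h : a < b) : gaussBinom q a b = 0 :=
  Finset.prod_eq_zero (Finset.mem_range.2 h) (by simp)

theorem prod_pow_sub_pow_ne_zero (hq : 1 < q) (b : ℕ) :
    ∏ j ∈ Finset.range b, ((q : ℚ) ^ b - (q : ℚ) ^ j) ≠ 0 :=
  Finset.prod_ne_zero_iff.2 fun _ hj => pow_sub_pow_ne_zero hq (Finset.mem_range.1 hj).ne

theorem prod_succ_pow_sub_pow (x : ℚ) (a b : ℕ) :
    ∏ j ∈ Finset.range (b + 1), (x ^ (a + 1) - x ^ j) =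
      (x ^ (a + 1) - 1) * x ^ b * ∏ j ∈ Finset.range b, (x ^ a - x ^ j) := by
  rw [Finset.prod_range_succ', pow_zero]
  have : ∀ j, x ^ (a + 1) - x ^ (j + 1) = x * (x ^ a - x ^ j) := fun j => by ring
  simp only [this, Finset.prod_mul_distrib, Finset.prod_const, Finset.card_range]
  ring

/-- The `q`-analogue of Pascal's rule. -/
theorem gaussBinom_succ_succ (hq : 1 < q) (a b : ℕ) :
    gaussBinom q (a + 1) (b + 1) =
      gaussBinom q a b + (q : ℚ) ^ (b + 1) * gaussBinom q a (b + 1) := by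
  have h1 := prod_pow_sub_pow_ne_zero hq b
  have h2 : (q : ℚ) ^ (b + 1) - 1 ≠ 0 := by
    simpa using pow_sub_pow_ne_zero hq (a := b + 1) (j := 0) (by omega)
  have h3 : (q : ℚ) ^ b ≠ 0 := pow_ne_zero _ (by exact_mod_cast (by omega : q ≠ 0))
  simp only [gaussBinom, Finset.prod_div_distrib, prod_succ_pow_sub_pow]
  rw [Finset.prod_range_succ (fun j => (q : ℚ) ^ a - (q : ℚ) ^ j)]
  field_simp
  ring

/-- The Möbius function of an interval of length `j` in a lattice of subspaces over a field with
`q` elements. -/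
def mu (q j : ℕ) : ℚ :=
  (-1) ^ j * (q : ℚ) ^ j.choose 2

theorem mu_succ (q j : ℕ) : mu q (j + 1) = -((q : ℚ) ^ j * mu q j) := by
  have : (j + 1).choose 2 = j + j.choose 2 := by
    rw [Nat.choose_succ_succ' j 1, Nat.choose_one_right]
  rw [mu, mu, this]
  ring

/-- Pascal's rule makes the partial sums telescope. At the cutoff k = n + 1 the right-hand factor
vanishes, which gives the full alternating sum. -/
theorem sum_range_gaussBinom_succ_mul_mu (hq : 1 < q) (n k : ℕ) :
    ∑ j ∈ Finset.range (k + 1), gaussBinom q (n + 1) j * mu q j =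
      (q : ℚ) ^ k * mu q k * gaussBinom q n k := by
  induction k with
  | zero => simp [gaussBinom_zero_right]
  | succ k ih =>
    rw [Finset.sum_range_succ, ih, gaussBinom_succ_succ hq, mu_succ]
    ring

/-- The `q`-binomial theorem at the point where it gives an alternating sum. -/
theorem sum_range_gaussBinom_mul_mu (hq : 1 < q) (n : ℕ) :
    ∑ j ∈ Finset.range (n + 1), gaussBinom q n j * mu q j = if n = 0 then 1 else 0 := by
  cases n with
  | zero => simp [gaussBinom_zero_right, mu]
  | succ n =>
    rw [sum_range_gaussBinom_succ_mul_mu hq, gaussBinom_eq_zero_of_lt (Nat.lt_succ_self n)]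
    simp

end GaussBinom

/-! ### Counting subspaces -/

section Counting

variable {F V : Type*} [Field F] [AddCommGroup V] [Module F V]

/-- A linearly independent family of `k` vectors is a basis of a unique subspace of
dimension `k`. -/
theorem bijective_sigma_linearIndependent (F V : Type*) [Field F] [AddCommGroup V]
    [Module F V] [FiniteDimensional F V] (k : ℕ) :
    Function.Bijective fun p : (Σ W : {W : Submodule F V // finrank F W = k},
        {s : Fin k → W.1 // LinearIndependent F s}) =>
      (⟨fun i => p.2.1 i, p.2.2.map' (Submodule.subtype _) (Submodule.ker_subtype _)⟩ :
        {s : Fin k → V // LinearIndependent F s}) := by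
  constructor
  · rintro ⟨⟨W, hW⟩, ⟨s, hs⟩⟩ ⟨⟨W', hW'⟩, ⟨s', hs'⟩⟩ h
    have hspan : ∀ (W : Submodule F V), finrank F W = k → ∀ s : Fin k → W,
        LinearIndependent F s → Submodule.span F (Set.range fun i => (s i : V)) = W := by
      intro W hW s hs
      have hs' : LinearIndependent F (fun i => (s i : V)) :=
        hs.map' (Submodule.subtype _) (Submodule.ker_subtype _)
      apply Submodule.eq_of_le_of_finrank_eq
      · rw [Submodule.span_le]
        rintro _ ⟨i, rfl⟩
        exact (s i).2
      · rw [finrank_span_eq_card hs', hW, Fintype.card_fin]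
    have hfun : (fun i => (s i : V)) = fun i => (s' i : V) := congrArg Subtype.val h
    obtain rfl : W = W' := by
      rw [← hspan W hW s hs, ← hspan W' hW' s' hs', hfun]
    obtain rfl : s = s' := funext fun i => Subtype.ext (congrFun hfun i)
    rfl
  · rintro ⟨s, hs⟩
    exact ⟨⟨⟨Submodule.span F (Set.range s), by simp [finrank_span_eq_card hs]⟩,
      ⟨fun i => ⟨s i, Submodule.subset_span ⟨i, rfl⟩⟩,
        LinearIndependent.of_comp (Submodule.subtype _) hs⟩⟩, rfl⟩

variable [Fintype F] [Finite V]

theorem natCast_card_linearIndependent (F V : Type*) [Field F] [AddCommGroup V]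
    [Module F V] [Fintype F] [Finite V] (k : ℕ) :
    (Nat.card {s : Fin k → V // LinearIndependent F s} : ℚ) =
      ∏ j ∈ Finset.range k, ((Fintype.card F : ℚ) ^ finrank F V - (Fintype.card F : ℚ) ^ j) := by
  rcases le_or_gt k (finrank F V) with hk | hk
  · rw [card_linearIndependent hk, Finset.prod_range, Nat.cast_prod]
    refine Finset.prod_congr rfl fun i _ => ?_
    rw [Nat.cast_sub (Nat.pow_le_pow_right Fintype.card_pos (i.2.le.trans hk))]
    push_cast
    rfl
  · rw [Finset.prod_eq_zero (Finset.mem_range.2 hk) (sub_self _), Nat.cast_eq_zero]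
    have : IsEmpty {s : Fin k → V // LinearIndependent F s} :=
      ⟨fun s => hk.not_ge (by simpa using s.2.fintype_card_le_finrank)⟩
    exact Nat.card_of_isEmpty

/-- Double count independent k-tuples by their span: every k-dimensional subspace has the same
number of ordered bases, the denominator of the Gaussian binomial. -/
theorem natCast_card_finrank_eq (F V : Type*) [Field F] [AddCommGroup V]
    [Module F V] [Fintype F] [Finite V] (k : ℕ) :
    (Nat.card {W : Submodule F V // finrank F W = k} : ℚ) =
      gaussBinom (Fintype.card F) (finrank F V) k := by
  have : Fintype {W : Submodule F V // finrank F W = k} := Fintype.ofFinite _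
  have h := natCast_card_linearIndependent F V k
  rw [← Nat.card_congr (Equiv.ofBijective _ (bijective_sigma_linearIndependent F V k)), Nat.card_sigma, Nat.cast_sum] at h
  have h' : ∀ W : {W : Submodule F V // finrank F W = k},
      (Nat.card {s : Fin k → W.1 // LinearIndependent F s} : ℚ) =
        ∏ j ∈ Finset.range k, ((Fintype.card F : ℚ) ^ k - (Fintype.card F : ℚ) ^ j) := by
    intro W
    rw [natCast_card_linearIndependent, W.2]
  rw [Finset.sum_congr rfl fun W _ => h' W, Finset.sum_const, nsmul_eq_mul, Finset.card_univ,
    ← Nat.card_eq_fintype_card] at h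
  rw [gaussBinom, Finset.prod_div_distrib, ← h,
    mul_div_cancel_right₀ _ (prod_pow_sub_pow_ne_zero Fintype.one_lt_card k)]

variable [Fintype (Submodule F V)]

/-- The slack in `N` costs nothing, since Gaussian binomials beyond the dimension vanish. It is
needed because `coeff` lets v_i run up to dim U_i, not just dim(H_i^⊥ ∩ U_i). -/
theorem sum_submodule_finrank (g : ℕ → ℚ) {N : ℕ} (hN : finrank F V ≤ N) :
    ∑ W : Submodule F V, g (finrank F W) =
      ∑ k ∈ Finset.Iic N, gaussBinom (Fintype.card F) (finrank F V) k * g k := by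
  classical
  rw [← Finset.sum_fiberwise_of_maps_to (s := Finset.univ) (t := Finset.Iic N)
    (g := fun W : Submodule F V => finrank F W)
    (fun W _ => Finset.mem_Iic.2 ((Submodule.finrank_le W).trans hN))]
  refine Finset.sum_congr rfl fun k _ => ?_
  rw [← natCast_card_finrank_eq, Nat.card_eq_fintype_card, Fintype.card_subtype,
    ← nsmul_eq_mul, ← Finset.sum_const]
  exact Finset.sum_congr rfl fun W hW => by rw [(Finset.mem_filter.1 hW).2]

open scoped Classical in
theorem sum_submodule_le_finrank (D : Submodule F V) (g : ℕ → ℚ) {N : ℕ} (hN : finrank F D ≤ N) :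
    ∑ W : Submodule F V with W ≤ D, g (finrank F W) =
      ∑ k ∈ Finset.Iic N, gaussBinom (Fintype.card F) (finrank F D) k * g k := by
  have : Fintype (Submodule F D) := Fintype.ofFinite _
  rw [← sum_submodule_finrank g hN, ← Finset.sum_subtype_eq_sum_filter,
    Finset.subtype_univ]
  symm
  refine Fintype.sum_equiv D.mapIic.toEquiv _ _ fun W => ?_
  congr 1
  exact (Submodule.equivMapOfInjective D.subtype D.injective_subtype W).finrank_eq

theorem finrank_comap_mkQ {F V : Type*} [Field F] [AddCommGroup V] [Module F V]
    [FiniteDimensional F V] (D : Submodule F V) (W : Submodule F (V ⧸ D)) :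
    finrank F (W.comap D.mkQ) = finrank F W + finrank F D := by
  have h := LinearMap.finrank_range_add_finrank_ker (D.mkQ.domRestrict (W.comap D.mkQ))
  rw [LinearMap.range_domRestrict, LinearMap.ker_domRestrict, Submodule.ker_mkQ,
    Submodule.map_comap_eq_of_surjective D.mkQ_surjective] at h
  rw [← h, (Submodule.comapSubtypeEquivOfLe (Submodule.le_comap_mkQ D W)).finrank_eq]

open scoped Classical in
-- Subspaces above D correspond to subspaces of V ⧸ D, so this is the alternating q-binomial sum for
-- dim(V ⧸ D).
theorem sum_submodule_ge_mu (D : Submodule F V) :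
    ∑ W : Submodule F V with D ≤ W, mu (Fintype.card F) (finrank F W - finrank F D) =
      if D = ⊤ then 1 else 0 := by
  have : Finite (V ⧸ D) := Finite.of_surjective _ D.mkQ_surjective
  have : Fintype (Submodule F (V ⧸ D)) := Fintype.ofFinite _
  have h : finrank F (V ⧸ D) = 0 ↔ D = ⊤ := by
    rw [finrank_zero_iff, Submodule.Quotient.subsingleton_iff]
  simp only [← h]
  rw [← sum_range_gaussBinom_mul_mu (Fintype.one_lt_card (α := F)), Finset.range_eq_Ico,
    ← Nat.bot_eq_zero, Finset.Ico_add_one_right_eq_Icc, Finset.Icc_bot, ← sum_submodule_finrank _ le_rfl,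
    ← Finset.sum_subtype_eq_sum_filter, Finset.subtype_univ]
  symm
  refine Fintype.sum_equiv (Submodule.comapMkQRelIso D).toEquiv _ _ fun W => ?_
  congr 1
  exact (Nat.sub_eq_of_eq_add (finrank_comap_mkQ D W)).symm

open scoped Classical in
/-- The values of `mu` are those of the Möbius function of the lattice of subspaces. -/
theorem sum_submodule_Icc_mu (D U : Submodule F V) :
    ∑ W : Submodule F V with D ≤ W ∧ W ≤ U, mu (Fintype.card F) (finrank F W - finrank F D) =
      if D = U then 1 else 0 := by
  by_cases hDU : D ≤ U
  -- Take U itself as the ambient space, which reduces the interval to the case of top element ⊤.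
  · have : Fintype (Submodule F U) := Fintype.ofFinite _
    obtain ⟨D, rfl⟩ : ∃ D' : Submodule F U, D = D'.map U.subtype :=
      ⟨D.comap U.subtype, by simpa [Submodule.map_comap_subtype] using hDU⟩
    have hrank : ∀ W : Submodule F U, finrank F (W.map U.subtype) = finrank F W := fun W =>
      (Submodule.equivMapOfInjective U.subtype U.injective_subtype W).finrank_eq.symm
    have htop : D.map U.subtype = U ↔ D = ⊤ := by
      rw [← (Submodule.map_injective_of_injective U.injective_subtype).eq_iff,
        Submodule.map_subtype_top]
    simp only [htop]
    rw [← sum_submodule_ge_mu D]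
    symm
    refine Finset.sum_bij (fun W _ => W.map U.subtype) ?_ ?_ ?_ ?_
    · intro W hW
      simp only [Finset.mem_filter, Finset.mem_univ, true_and] at hW ⊢
      exact ⟨Submodule.map_mono hW, Submodule.map_subtype_le _ _⟩
    · intro W _ W' _ h
      exact Submodule.map_injective_of_injective U.injective_subtype h
    · intro W hW
      simp only [Finset.mem_filter, Finset.mem_univ, true_and] at hW ⊢
      refine ⟨W.comap U.subtype, Submodule.map_le_iff_le_comap.1 hW.1, ?_⟩
      simpa [Submodule.map_comap_subtype] using hW.2
    · intro W _
      rw [hrank, hrank]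
  · rw [if_neg (fun h => hDU h.le), Finset.sum_eq_zero]
    intro W hW
    simp only [Finset.mem_filter, Finset.mem_univ, true_and] at hW
    exact absurd (hW.1.trans hW.2) hDU

end Counting

open scoped Classical in
/-- A function on a finite partial order is determined by its sums over the principal lower
sets. -/
theorem eq_of_sum_le_eq {α R : Type*} [Fintype α] [PartialOrder α] [AddCommGroup R] {f g : α → R}
    (h : ∀ u, ∑ w with w ≤ u, f w = ∑ w with w ≤ u, g w) : f = g := by
  funext u
  induction u using WellFoundedLT.induction with
  | ind u ih =>
    have key : ∀ f : α → R, ∑ w with w ≤ u, f w = f u + ∑ w with w < u, f w := by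
      intro f
      have hu : (Finset.univ.filter fun w => w ≤ u) =
          insert u (Finset.univ.filter fun w => w < u) := by
        ext w
        simp [le_iff_eq_or_lt]
      rw [hu, Finset.sum_insert (by simp)]
    have h1 := h u
    rw [key f, key g, Finset.sum_congr rfl fun w hw => ih w (Finset.mem_filter.1 hw).2] at h1
    exact add_right_cancel h1

/-! ### Character sums -/

theorem addChar_map_sum {ι A R : Type*} [AddCommMonoid A] [CommMonoid R] (χ : AddChar A R)
    (s : Finset ι) (f : ι → A) : χ (∑ i ∈ s, f i) = ∏ i ∈ s, χ (f i) :=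
  map_prod χ.toMonoidHom (fun i => Multiplicative.ofAdd (f i)) s

section CharacterSums

open scoped Classical in
/-- Orthogonality of characters, for a linear functional on a subspace. -/
theorem sum_addChar_linearMap {F M : Type*} [Field F] [AddCommGroup M] [Module F M] [Fintype M]
    {χ : AddChar F ℂ} (hχ : χ ≠ 1) (C : Submodule F M) (f : M →ₗ[F] F) :
    ∑ x with x ∈ C, χ (f x) = if ∀ x ∈ C, f x = 0 then (Nat.card C : ℂ) else 0 := by
  have h := AddChar.sum_eq_ite (χ.compAddMonoidHom (f.comp C.subtype).toAddMonoidHom)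
  have hzero : χ.compAddMonoidHom (f.comp C.subtype).toAddMonoidHom = 0 ↔ ∀ x ∈ C, f x = 0 := by
    constructor
    · intro h0 x hx
      by_contra hfx
      obtain ⟨c, hc⟩ := AddChar.ne_one_iff.1 hχ
      apply hc
      -- Rescaling x makes the functional take the value c, where χ is nontrivial.
      have := DFunLike.congr_fun h0 ((c / f x) • ⟨x, hx⟩ : C)
      simpa [hfx] using this
    · intro h0
      ext ⟨x, hx⟩
      simp [h0 x hx]
  rw [if_congr hzero rfl rfl, ← Nat.card_eq_fintype_card] at h
  rw [← h, ← Finset.sum_subtype_eq_sum_filter, Finset.subtype_univ]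
  rfl

variable {F : Type*} [Field F] {a b : ℕ}

theorem colsp_le_iff {Y : Matrix (Fin a) (Fin b) F} {U : Submodule F (Fin a → F)} :
    colsp Y ≤ U ↔ ∀ j, Y.col j ∈ U := by
  rw [colsp, Submodule.span_le, Set.range_subset_iff]
  rfl

/-- The matrices whose column space is contained in a given subspace. -/
def colspLE (b : ℕ) (U : Submodule F (Fin a → F)) : Submodule F (Matrix (Fin a) (Fin b) F) where
  carrier := {Y | ∀ j, Y.col j ∈ U}
  zero_mem' := fun _ => U.zero_mem
  add_mem' := fun hY hZ j => U.add_mem (hY j) (hZ j)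
  smul_mem' := fun c _ hY j => U.smul_mem c (hY j)

theorem mem_colspLE {U : Submodule F (Fin a → F)} {Y : Matrix (Fin a) (Fin b) F} :
    Y ∈ colspLE b U ↔ colsp Y ≤ U :=
  colsp_le_iff.symm

theorem card_colspLE [Fintype F] (U : Submodule F (Fin a → F)) :
    Nat.card (colspLE b U) = Fintype.card F ^ (b * finrank F U) := by
  have e : colspLE b U ≃ (Fin b → U) :=
    { toFun := fun Y j => ⟨Y.1.col j, Y.2 j⟩
      invFun := fun s => ⟨fun i j => (s j : Fin a → F) i, fun j => (s j).2⟩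
      left_inv := fun _ => rfl
      right_inv := fun _ => rfl }
  rw [Nat.card_congr e, Nat.card_fun, Nat.card_eq_fintype_card (α := Fin b), Fintype.card_fin,
    Module.natCard_eq_pow_finrank (K := F), Nat.card_eq_fintype_card, ← pow_mul, mul_comm]

/-- The linear functional `Y ↦ Tr(X Yᵀ)`. -/
def tracePairing (X : Matrix (Fin a) (Fin b) F) : Matrix (Fin a) (Fin b) F →ₗ[F] F where
  toFun Y := (X * Yᵀ).trace
  map_add' Y Z := by simp [Matrix.mul_add]
  map_smul' c Y := by simp

theorem tracePairing_apply (X Y : Matrix (Fin a) (Fin b) F) :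
    tracePairing X Y = (X * Yᵀ).trace :=
  rfl

theorem tracePairing_comm (X Y : Matrix (Fin a) (Fin b) F) :
    tracePairing X Y = tracePairing Y X := by
  rw [tracePairing_apply, tracePairing_apply, ← Matrix.trace_transpose, Matrix.transpose_mul,
    Matrix.transpose_transpose]

theorem tracePairing_eq_sum (X Y : Matrix (Fin a) (Fin b) F) :
    tracePairing X Y = ∑ j, X.col j ⬝ᵥ Y.col j := by
  simp only [tracePairing_apply, Matrix.trace, Matrix.diag, Matrix.mul_apply, dotProduct,
    Matrix.transpose_apply, Matrix.col_apply]
  exact Finset.sum_comm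

/-- The pairing is the sum of the dot products of matching columns, and the columns of Y range
freely over U; matrices with one nonzero column suffice as tests. -/
theorem tracePairing_eq_zero_on_colspLE_iff {X : Matrix (Fin a) (Fin b) F}
    {U : Submodule F (Fin a → F)} :
    (∀ Y ∈ colspLE b U, tracePairing X Y = 0) ↔ U ≤ orth (colsp X) := by
  constructor
  · intro h y hy
    change ∀ x ∈ colsp X, x ⬝ᵥ y = 0
    intro x hx
    induction hx using Submodule.span_induction with
    | mem x hx =>
      obtain ⟨j, rfl⟩ := hx
      have h1 := h (Matrix.of fun i k => if k = j then y i else 0) (by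
        intro k
        by_cases hk : k = j
        · convert! hy using 1
          ext i
          simp [hk]
        · convert! U.zero_mem using 1
          ext i
          simp [hk])
      rw [tracePairing_eq_sum, Finset.sum_eq_single j] at h1
      · convert! h1 using 2
        ext i
        simp
      · intro k _ hk
        simp [dotProduct, hk]
      · simp
    | zero => simp
    | add x z _ _ hx hz => rw [add_dotProduct, hx, hz, add_zero]
    | smul c x _ hx => rw [smul_dotProduct, hx, smul_zero]
  · intro h Y hY
    rw [tracePairing_eq_sum]
    exact Finset.sum_eq_zero fun j _ => h (hY j) _ (Submodule.subset_span ⟨j, rfl⟩)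

/-- The factor of `coeff` that belongs to one block. -/
noncomputable def blockCoeff [Fintype F] (b : ℕ) (U H : Submodule F (Fin a → F)) : ℚ :=
  ∑ v ∈ Finset.Iic (finrank F U), (Fintype.card F : ℚ) ^ (b * v) *
    ((-1 : ℚ) ^ (finrank F U - v) * (Fintype.card F : ℚ) ^ ((finrank F U - v).choose 2) *
      gaussBinom (Fintype.card F) (finrank F ↥(orth H ⊓ U)) v)

variable [Fintype F]

open scoped Classical in
theorem sum_colsp_le_addChar {χ : AddChar F ℂ} (hχ : χ ≠ 1) (X : Matrix (Fin a) (Fin b) F)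
    (U : Submodule F (Fin a → F)) :
    ∑ Y with colsp Y ≤ U, χ (tracePairing X Y) =
      if U ≤ orth (colsp X) then (Fintype.card F : ℂ) ^ (b * finrank F U) else 0 := by
  have h := sum_addChar_linearMap hχ (colspLE b U) (tracePairing X)
  rw [card_colspLE, if_congr tracePairing_eq_zero_on_colspLE_iff rfl rfl, Nat.cast_pow] at h
  simpa only [mem_colspLE] using h

variable [Fintype (Submodule F (Fin a → F))]

open scoped Classical in
theorem blockCoeff_eq_sum (b : ℕ) (U H : Submodule F (Fin a → F)) :
    blockCoeff b U H = ∑ W : Submodule F (Fin a → F) with W ≤ orth H ⊓ U,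
      (Fintype.card F : ℚ) ^ (b * finrank F W) *
        mu (Fintype.card F) (finrank F U - finrank F W) := by
  rw [sum_submodule_le_finrank (orth H ⊓ U) (fun w => (Fintype.card F : ℚ) ^ (b * w) *
    mu (Fintype.card F) (finrank F U - w)) (Submodule.finrank_mono inf_le_right)]
  refine Finset.sum_congr rfl fun v _ => ?_
  rw [mu]
  ring

open scoped Classical in
-- After exchanging the sums, the Möbius values over V ∈ [W, U] cancel unless W = U, and that term
-- occurs only if U ≤ H^⊥.
theorem sum_le_blockCoeff (b : ℕ) (U H : Submodule F (Fin a → F)) :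
    ∑ V with V ≤ U, blockCoeff b V H =
      if U ≤ orth H then (Fintype.card F : ℚ) ^ (b * finrank F U) else 0 := by
  simp only [blockCoeff_eq_sum]
  rw [Finset.sum_comm' (t' := Finset.univ.filter (· ≤ orth H))
    (s' := fun W => Finset.univ.filter fun V => W ≤ V ∧ V ≤ U)]
  · simp only [← Finset.mul_sum, sum_submodule_Icc_mu, mul_ite, mul_one, mul_zero]
    rw [Finset.sum_ite_eq']
    simp
  · intro V W
    simp only [Finset.mem_filter, Finset.mem_univ, true_and, le_inf_iff]
    tauto

open scoped Classical in
/-- The characters of one block, summed over the matrices with a given column space. -/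
theorem sum_colsp_eq_addChar {χ : AddChar F ℂ} (hχ : χ ≠ 1) (X : Matrix (Fin a) (Fin b) F)
    (U : Submodule F (Fin a → F)) :
    ∑ Y with colsp Y = U, χ (tracePairing X Y) = (blockCoeff b U (colsp X) : ℂ) := by
  refine congrFun (eq_of_sum_le_eq (f := fun U => ∑ Y with colsp Y = U, χ (tracePairing X Y))
    (g := fun U => (blockCoeff b U (colsp X) : ℂ)) fun V => ?_) U
  rw [← Rat.cast_sum, sum_le_blockCoeff]
  simp only [Finset.sum_filter (s := Finset.univ) (fun Y : Matrix (Fin a) (Fin b) F => _ = _)]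
  rw [Finset.sum_comm]
  simp only [Finset.sum_ite_eq, Finset.mem_filter, Finset.mem_univ, true_and]
  rw [← Finset.sum_filter, sum_colsp_le_addChar hχ]
  split_ifs <;> simp

end CharacterSums

/-! ### Tuples of matrices -/

section Tuples

variable {F : Type*} [Field F] {t : ℕ} {n m : Fin t → ℕ}

/-- The linear functional `Y ↦ ∑ i, Tr(X i (Y i)ᵀ)`. -/
def pairing (X : Space F n m) : Space F n m →ₗ[F] F :=
  ∑ i, (tracePairing (X i)).comp (LinearMap.proj i)

theorem pairing_apply (X Y : Space F n m) : pairing X Y = ∑ i, tracePairing (X i) (Y i) := by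
  simp [pairing]

theorem pairing_comm (X Y : Space F n m) : pairing X Y = pairing Y X := by
  simp only [pairing_apply, tracePairing_comm]

theorem mem_dual_iff {C : Submodule F (Space F n m)} {Y : Space F n m} :
    Y ∈ dual C ↔ ∀ X ∈ C, pairing Y X = 0 := by
  simp only [pairing_comm Y, pairing_apply]
  rfl

theorem eq_zero_of_pairing_eq_zero {X : Space F n m} (h : ∀ Y, pairing X Y = 0) : X = 0 := by
  ext i j k
  have h1 := h (Pi.single i (Matrix.single j k 1))
  rw [pairing_apply, Finset.sum_eq_single i] at h1
  · simpa [tracePairing_apply, Matrix.trace_mul_single] using h1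
  · intro i' _ hi'
    simp [hi']
  · simp

theorem support_neg (X : Space F n m) : support (-X) = support X := by
  have h : ∀ X : Space F n m, support (-X) ≤ support X := fun X i =>
    colsp_le_iff.2 fun j =>
      Submodule.neg_mem _ (Submodule.subset_span (Set.mem_range_self (f := (X i).col) j))
  exact le_antisymm (h X) (by simpa using h (-X))

/-- A basis of U fills the first dim U ≤ a ≤ b columns; the rest are zero. -/
theorem exists_colsp_eq {a b : ℕ} (hab : a ≤ b) (U : Submodule F (Fin a → F)) :
    ∃ X : Matrix (Fin a) (Fin b) F, colsp X = U := by
  have hU : finrank F U ≤ b := (Submodule.finrank_le U).trans (by simpa using hab)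
  let B := finBasis F U
  refine ⟨Matrix.of fun i j => if h : (j : ℕ) < finrank F U then (B ⟨j, h⟩ : Fin a → F) i else 0,
    le_antisymm (colsp_le_iff.2 fun j => ?_) ?_⟩
  · by_cases h : (j : ℕ) < finrank F U
    · convert! (B ⟨j, h⟩).2 using 1
      ext i
      simp [h]
    · convert! U.zero_mem using 1
      ext i
      simp [h]
  · have hspan : U = Submodule.span F (Set.range fun k => (B k : Fin a → F)) := by
      rw [show (fun k => (B k : Fin a → F)) = U.subtype ∘ B from rfl, Set.range_comp,
        Submodule.span_image, B.span_eq, Submodule.map_subtype_top]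
    conv_lhs => rw [hspan]
    refine Submodule.span_le.2 ?_
    rintro _ ⟨k, rfl⟩
    refine Submodule.subset_span ⟨⟨k, k.2.trans_le hU⟩, ?_⟩
    ext i
    simp

theorem support_surjective (hnm : ∀ i, n i ≤ m i) :
    Function.Surjective (support : Space F n m → Lattice F n) := by
  intro U
  choose X hX using fun i => exists_colsp_eq (hnm i) (U i)
  exact ⟨X, funext hX⟩

variable [Fintype F]

theorem coeff_eq_prod (m : Fin t → ℕ) (U H : Lattice F n) :
    coeff m U H = ∏ i, blockCoeff (m i) (U i) (H i) := by
  have hIic : Finset.Iic (dimVec U) = Fintype.piFinset fun i => Finset.Iic (finrank F (U i)) := by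
    ext v
    simp [Pi.le_def, dimVec]
  simp only [blockCoeff]
  rw [Finset.prod_univ_sum, coeff, hIic]
  refine Finset.sum_congr rfl fun v _ => ?_
  rw [Finset.prod_mul_distrib (f := fun i => (Fintype.card F : ℚ) ^ (m i * v i)),
    Finset.prod_pow_eq_pow_sum]
  rfl

open scoped Classical in
/-- The characters, summed over the tuples with a given support. -/
theorem sum_support_eq_addChar {χ : AddChar F ℂ} (hχ : χ ≠ 1) (X : Space F n m)
    (U : Lattice F n) :
    ∑ Y : Space F n m with support Y = U, χ (pairing X Y) = (coeff m U (support X) : ℂ) := by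
  have hpi : (Finset.univ.filter fun Y : Space F n m => support Y = U) =
      Fintype.piFinset fun i => Finset.univ.filter fun Y => colsp Y = U i := by
    ext Y
    simp [funext_iff, support]
  have : ∀ i, Fintype (Submodule F (Fin (n i) → F)) := fun i => Fintype.ofFinite _
  rw [coeff_eq_prod, Rat.cast_prod, hpi]
  simp only [support, ← sum_colsp_eq_addChar hχ]
  rw [Finset.prod_univ_sum]
  refine Finset.sum_congr rfl fun Y _ => ?_
  rw [pairing_apply, addChar_map_sum]

open scoped Classical in
theorem sum_suppDist_mul {R : Type*} [CommSemiring R] (C : Submodule F (Space F n m))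
    (g : Lattice F n → R) :
    ∑ H, (suppDist C H : R) * g H = ∑ X with X ∈ C, g (support X) := by
  rw [← Finset.sum_fiberwise _ support]
  refine Finset.sum_congr rfl fun H _ => ?_
  rw [Finset.filter_filter, suppDist, Nat.card_eq_fintype_card, Fintype.card_subtype,
    ← nsmul_eq_mul, ← Finset.sum_const]
  exact Finset.sum_congr rfl fun X hX => by rw [(Finset.mem_filter.1 hX).2.2]

theorem sum_suppDist (C : Submodule F (Space F n m)) : ∑ H, suppDist C H = Nat.card C := by
  classical
  have h := sum_suppDist_mul C fun _ => (1 : ℕ)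
  rw [Nat.card_eq_fintype_card, Fintype.card_subtype]
  simpa using h

theorem exists_addChar_ne_one (F : Type*) [Field F] [Fintype F] : ∃ χ : AddChar F ℂ, χ ≠ 1 := by
  obtain ⟨χ, hχ⟩ := AddChar.exists_apply_ne_zero.2 (one_ne_zero (α := F))
  exact ⟨χ, AddChar.ne_one_iff.2 ⟨1, hχ⟩⟩

/-- The MacWilliams identity for the support distribution. -/
theorem card_mul_suppDist_dual (C : Submodule F (Space F n m)) (U : Lattice F n) :
    (Nat.card C : ℚ) * suppDist (dual C) U = ∑ H, (suppDist C H : ℚ) * coeff m U H := by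
  classical
  obtain ⟨χ, hχ⟩ := exists_addChar_ne_one F
  -- The identity is rational, but the characters take values in ℂ.
  rw [← Rat.cast_inj (α := ℂ)]
  push_cast
  rw [sum_suppDist_mul C fun H => (coeff m U H : ℂ)]
  simp only [← sum_support_eq_addChar hχ]
  have h : ∀ Y : Space F n m, ∑ X with X ∈ C, χ (pairing X Y) =
      if Y ∈ dual C then (Nat.card C : ℂ) else 0 := fun Y => by
    simp only [pairing_comm _ Y]
    rw [sum_addChar_linearMap hχ, if_congr mem_dual_iff rfl rfl]
  rw [Finset.sum_comm, Finset.sum_congr rfl fun Y _ => h Y, ← Finset.sum_filter,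
    Finset.filter_filter, Finset.sum_const, nsmul_eq_mul, mul_comm, suppDist,
    Nat.card_eq_fintype_card (α := {X // _}), Fintype.card_subtype]
  simp only [and_comm]

/-- Realise L as the support of some Z, which is where n_i ≤ m_i enters, and expand both factors as
character sums. Summing over all X leaves only Y = -Z, and negation preserves the support. -/
theorem sum_coeff_mul_coeff (hnm : ∀ i, n i ≤ m i) (U L : Lattice F n) :
    ∑ H, coeff m U H * coeff m H L = if U = L then (Nat.card (Space F n m) : ℚ) else 0 := by
  classical
  obtain ⟨χ, hχ⟩ := exists_addChar_ne_one F
  obtain ⟨Z, rfl⟩ := support_surjective hnm L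
  rw [← Rat.cast_inj (α := ℂ)]
  push_cast
  have h1 : ∀ H, (coeff m U H : ℂ) * coeff m H (support Z) =
      ∑ X with support X = H, coeff m U (support X) * χ (pairing Z X) := fun H => by
    rw [← sum_support_eq_addChar hχ Z, Finset.mul_sum]
    exact Finset.sum_congr rfl fun X hX => by rw [(Finset.mem_filter.1 hX).2]
  have h2 : ∀ Y : Space F n m, ∑ X, χ (pairing X Y) * χ (pairing Z X) =
      if Y = -Z then (Nat.card (Space F n m) : ℂ) else 0 := fun Y => by
    have h := sum_addChar_linearMap hχ ⊤ (pairing (n := n) (m := m) (Y + Z))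
    have hY : (∀ X ∈ (⊤ : Submodule F (Space F n m)), pairing (Y + Z) X = 0) ↔ Y = -Z := by
      rw [← add_eq_zero_iff_eq_neg]
      exact ⟨fun h0 => eq_zero_of_pairing_eq_zero fun X => h0 X trivial,
        fun h0 X _ => by rw [h0, pairing_comm, map_zero]⟩
    rw [if_congr hY rfl rfl, Nat.card_congr Submodule.topEquiv.toEquiv] at h
    rw [← h]
    simp only [Submodule.mem_top, Finset.filter_true]
    refine Finset.sum_congr rfl fun X _ => ?_
    rw [pairing_comm (Y + Z), map_add, AddChar.map_add_eq_mul, pairing_comm Z]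
  rw [Finset.sum_congr rfl fun H _ => h1 H, Finset.sum_fiberwise]
  simp only [← sum_support_eq_addChar hχ, Finset.sum_mul]
  rw [Finset.sum_comm, Finset.sum_congr rfl fun Y _ => h2 Y, Finset.sum_ite_eq']
  simp only [Finset.mem_filter, Finset.mem_univ, true_and, support_neg, eq_comm (a := U)]
  split_ifs <;> simp

theorem mulVec_coeff_injective (hnm : ∀ i, n i ≤ m i) :
    Function.Injective (Matrix.of (coeff m) : Matrix (Lattice F n) (Lattice F n) ℚ).mulVec := by
  classical
  have hsq : (Matrix.of (coeff m) : Matrix (Lattice F n) (Lattice F n) ℚ) * Matrix.of (coeff m) =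
      (Nat.card (Space F n m) : ℚ) • (1 : Matrix (Lattice F n) (Lattice F n) ℚ) := by
    ext U L
    simp only [Matrix.mul_apply, Matrix.of_apply, sum_coeff_mul_coeff hnm, Matrix.smul_apply,
      Matrix.one_apply, smul_eq_mul, mul_ite, mul_one, mul_zero]
  have hcard : (Nat.card (Space F n m) : ℚ) ≠ 0 := Nat.cast_ne_zero.2 Nat.card_pos.ne'
  intro w w' h
  have h1 := congrArg (Matrix.of (coeff m) : Matrix (Lattice F n) (Lattice F n) ℚ).mulVec h
  simp only [Matrix.mulVec_mulVec, hsq, Matrix.smul_mulVec, Matrix.one_mulVec] at h1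
  exact smul_right_injective _ hcard h1

end Tuples

end SumRank

theorem theorem5p3 {F : Type*} [Field F] [Fintype F] {t : ℕ} (ht : 1 ≤ t)
    (n m : Fin t → ℕ) (hn : ∀ i, 1 ≤ n i) (hnm : ∀ i, n i ≤ m i) (hm : Antitone m) :
    (∀ (C : Submodule F (SumRank.Space F n m)) (U : SumRank.Lattice F n),
      (SumRank.suppDist (SumRank.dual C) U : ℚ) =
        1 / (Nat.card C : ℚ) *
          ∑ H : SumRank.Lattice F n, (SumRank.suppDist C H : ℚ) * SumRank.coeff m U H) ∧
    (∀ C D : Submodule F (SumRank.Space F n m),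
      SumRank.suppDist C = SumRank.suppDist D →
        SumRank.suppDist (SumRank.dual C) = SumRank.suppDist (SumRank.dual D)) ∧
    (∃ T : (SumRank.Lattice F n → ℚ) ≃ₗ[ℚ] (SumRank.Lattice F n → ℚ),
      (∀ (w : SumRank.Lattice F n → ℚ) (U : SumRank.Lattice F n),
        T w U = ∑ H : SumRank.Lattice F n, w H * SumRank.coeff m U H) ∧
      ∀ C : Submodule F (SumRank.Space F n m),
        (fun U => (SumRank.suppDist (SumRank.dual C) U : ℚ)) =
          (1 / (Nat.card C : ℚ)) • T (fun H => (SumRank.suppDist C H : ℚ))) := by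
  have hcard : ∀ C : Submodule F (SumRank.Space F n m), (Nat.card C : ℚ) ≠ 0 := fun C =>
    Nat.cast_ne_zero.2 Nat.card_pos.ne'
  have hdual : ∀ (C : Submodule F (SumRank.Space F n m)) (U : SumRank.Lattice F n),
      (SumRank.suppDist (SumRank.dual C) U : ℚ) =
        1 / (Nat.card C : ℚ) *
          ∑ H : SumRank.Lattice F n, (SumRank.suppDist C H : ℚ) * SumRank.coeff m U H := by
    intro C U
    rw [← SumRank.card_mul_suppDist_dual, one_div, inv_mul_cancel_left₀ (hcard C)]
  refine ⟨hdual, ?_, ?_⟩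
  · intro C D hCD
    funext U
    -- The normalising factor |C| is itself the total mass of the support distribution.
    rw [← Nat.cast_inj (R := ℚ), hdual, hdual, ← SumRank.sum_suppDist C, ← SumRank.sum_suppDist D,
      hCD]
  · let K : Matrix (SumRank.Lattice F n) (SumRank.Lattice F n) ℚ := Matrix.of (SumRank.coeff m)
    have hK : ∀ w U, K.mulVecLin w U =
        ∑ H : SumRank.Lattice F n, w H * SumRank.coeff m U H := fun w U =>
      Finset.sum_congr rfl fun H _ => mul_comm _ _
    -- On a finite-dimensional space an injective endomorphism is bijective.
    refine ⟨LinearEquiv.ofInjectiveEndo K.mulVecLin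
      (SumRank.mulVec_coeff_injective hnm), hK, fun C => ?_⟩
    funext U
    exact (hdual C U).trans (congrArg _ (hK _ U).symm)
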